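/- There is a universal constant $C>0$ such that the following holds. Let $L\ge 0$ be an integer, let $d_1^l,d_2^l$ ($1\le l\le L$) be dimensions, and let $d>0$ and $\Psi>0$ be real numbers. Let $A^1,\dots,A^L$ be random real matrices, $A^l$ of size $d_1^l\times d_2^l$, such that every entry satisfies $A^l_{ij}\sim\mathcal N(0,\Psi)$ (mean $0$, variance $\Psi$) and, for each $l$, the entries of $A^l$ are independent. Let $\hat A^1,\dots,\hat A^L$ be obtained from $A^1,\dots,A^L$ by randomized magnitude-based pruning: conditionally on $(A^1,\dots,A^L)$, independently over all $(l,i,j)$ with $i\neq j$, one sets $\hat A^l_{ij}=0$ with probability $\exp\!\big(-(A^l_{ij})^2/(d\Psi)\big)$ and $\hat A^l_{ij}=A^l_{ij}$ otherwise, while the diagonal entries are kept, $\hat A^l_{ii}=A^l_{ii}$. Then for every layer $l\in\{1,\dots,L\}$ and every real $\epsilon_l>0$, with probability at least $1-\frac1{\epsilon_l}$, $$\|\hat A^l-A^l\|_2\le \epsilon_l\,\Gamma_l,\qquad \Gamma_l=C\left[\sqrt{\frac{d^{3/2}\Psi}{(d+2)^{3/2}}}\left(\sqrt{d_1^l}+\sqrt{d_2^l}\right)+\left(\frac{3\,d_1^l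 d_2^l\, d^{5/2}\Psi^2}{(d+2)^{5/2}}\right)^{1/4}\right],$$ where $\|\cdot\|_2$ denotes the spectral norm (the operator norm with respect to the Euclidean norms). -/

import Mathlib

open MeasureTheory ProbabilityTheory
open scoped NNReal

noncomputable section

/-- The positions `(l, i, j)` of the weights of a model with `L` layers, the `l`-th weight matrix
having `d₁ l` rows and `d₂ l` columns. -/
abbrev Entry {L : ℕ} (d₁ d₂ : Fin L → ℕ) : Type :=
  (l : Fin L) × (Fin (d₁ l) × Fin (d₂ l))

/-- A model: all the weights, with the product `σ`-algebra. -/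
abbrev Model {L : ℕ} (d₁ d₂ : Fin L → ℕ) : Type :=
  Entry d₁ d₂ → ℝ

/-- The weight matrix of layer `l`. -/
def Model.layer {L : ℕ} {d₁ d₂ : Fin L → ℕ} (A : Model d₁ d₂) (l : Fin L) :
    Matrix (Fin (d₁ l)) (Fin (d₂ l)) ℝ :=
  Matrix.of fun i j => A ⟨l, i, j⟩

open scoped Matrix.Norms.L2Operator in
/-- The spectral norm: the operator norm between Euclidean spaces. -/
def spectralNorm₂ {m n : ℕ} (M : Matrix (Fin m) (Fin n) ℝ) : ℝ := ‖M‖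

/-- The probability `exp (-a² / (d Ψ))` with which a weight of value `a` is pruned. -/
def pruneProb (d Ψ : ℝ≥0) (a : ℝ) : unitInterval :=
  ⟨Real.exp (-a ^ 2 / (d * Ψ)), (Real.exp_pos _).le, by
    rw [Real.exp_le_one_iff]
    exact div_nonpos_of_nonpos_of_nonneg (by nlinarith [sq_nonneg a]) (by positivity)⟩

/-- The law of the output of the pruning step at the position `e` when the weight there is `a`:
off the diagonal it is `0` with probability `exp (-a² / (d Ψ))` and `a` otherwise;
on the diagonal the weight is kept. -/
def pruneEntry {L : ℕ} {d₁ d₂ : Fin L → ℕ} (d Ψ : ℝ≥0) (e : Entry d₁ d₂) (a : ℝ) : Measure ℝ :=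
  if (e.2.1 : ℕ) = (e.2.2 : ℕ) then Measure.dirac a
  else bernoulliMeasure 0 a (pruneProb d Ψ a)

instance {L : ℕ} {d₁ d₂ : Fin L → ℕ} (d Ψ : ℝ≥0) (e : Entry d₁ d₂) (a : ℝ) :
    IsProbabilityMeasure (pruneEntry d Ψ e a) := by
  unfold pruneEntry
  split_ifs <;> infer_instance

theorem measurable_pruneEntry {L : ℕ} {d₁ d₂ : Fin L → ℕ} (d Ψ : ℝ≥0) (e : Entry d₁ d₂) :
    Measurable (pruneEntry d Ψ e) := by
  unfold pruneEntry
  split_ifs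
  · exact Measure.measurable_dirac
  · refine Measure.measurable_of_measurable_coe _ fun s hs => ?_
    have h : Measurable (pruneProb d Ψ) := by
      unfold pruneProb
      fun_prop
    have h1 : Measurable fun a : ℝ => unitInterval.toNNReal (pruneProb d Ψ a) := by
      fun_prop
    have h2 : Measurable fun a : ℝ =>
        unitInterval.toNNReal (unitInterval.symm (pruneProb d Ψ a)) := by
      fun_prop
    have h3 : Measurable fun a : ℝ => s.indicator (1 : ℝ → ENNReal) a :=
      measurable_one.indicator hs
    simp only [bernoulliMeasure_def, Measure.add_apply, Measure.smul_apply,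
      Measure.dirac_apply' _ hs, ENNReal.smul_def, smul_eq_mul]
    exact (h1.coe_nnreal_ennreal.mul_const _).add (h2.coe_nnreal_ennreal.mul h3)

/-- Magnitude-based pruning, as a Markov kernel sending a model `A` to the law of the pruned
model: given `A`, the positions are pruned independently of each other. -/
def mbp {L : ℕ} (d₁ d₂ : Fin L → ℕ) (d Ψ : ℝ≥0) : Kernel (Model d₁ d₂) (Model d₁ d₂) where
  toFun A := Measure.pi fun e => pruneEntry d Ψ e (A e)
  measurable' := by
    refine Measurable.measure_of_isPiSystem_of_isProbabilityMeasure generateFrom_pi.symm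
      isPiSystem_pi ?_
    rintro _ ⟨s, hs, rfl⟩
    simp only [Measure.pi_pi]
    refine Finset.measurable_prod _ fun e _ => ?_
    have hse : MeasurableSet (s e) := by simpa using hs e (Set.mem_univ e)
    exact (Measure.measurable_coe hse).comp
      ((measurable_pruneEntry d Ψ e).comp (measurable_pi_apply e))

instance {L : ℕ} (d₁ d₂ : Fin L → ℕ) (d Ψ : ℝ≥0) : IsMarkovKernel (mbp d₁ d₂ d Ψ) :=
  ⟨fun A => inferInstanceAs
    (IsProbabilityMeasure (Measure.pi fun e => pruneEntry d Ψ e (A e)))⟩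

/-- The quantity `Γ` for a layer of size `m × n`. -/
def layerGamma (C d Ψ : ℝ) (m n : ℕ) : ℝ :=
  C * (√(d ^ (3 / 2 : ℝ) * Ψ / (d + 2) ^ (3 / 2 : ℝ)) * (√(m : ℝ) + √(n : ℝ))
    + (3 * m * n * d ^ (5 / 2 : ℝ) * Ψ ^ 2 / (d + 2) ^ (5 / 2 : ℝ)) ^ (1 / 4 : ℝ))

end

/-!
For unit vectors `x` and `y` the value `⟪x, X y⟫` is the mean of the bilinear form of `X` under the
Gaussian measure centred at `(x, y)` with covariance `v`. Changing this measure to the centred one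
costs `1 / v` whatever `x` and `y` are, so, up to this cost, the whole spectral norm of `X` is
controlled by a single exponential moment of the bilinear form at a random point independent of `X`.
If the entries satisfy `E exp (t Xᵢⱼ - t² Vᵢⱼ / 2) ≤ 1`, subtracting the penalty
`t / 2 * ∑ Vᵢⱼ wᵢ² wⱼ²` makes this moment at most `1`, because the entries are independent. The mean
penalty involves only the largest row sum, the largest column sum and the total sum of `V`; these
sums exceed their expectations by at most the root of a sum of variances, and one optimises `v`
and `t`.

Pruning changes an off-diagonal `𝒩(0, Ψ)` weight by `0`, except with probability `√(d / (d + 2))`,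
when the change is `𝒩(0, Ψ d / (d + 2))`: multiplying the Gaussian density by the pruning
probability gives a multiple of another Gaussian density. So `Vᵢⱼ` can be taken to be
`Ψ d / (d + 2)` or `0` according to whether the weight is pruned.
-/

section ProductMeasures

variable {ι : Type*} [Fintype ι] {E : ι → Type*} [∀ i, MeasurableSpace (E i)]
  (μ : ∀ i, Measure (E i)) [∀ i, IsProbabilityMeasure (μ i)]

theorem lintegral_pi_prod {f : ∀ i, E i → ENNReal} (hf : ∀ i, Measurable (f i)) :
    ∫⁻ u, ∏ i, f i (u i) ∂Measure.pi μ = ∏ i, ∫⁻ a, f i a ∂μ i := by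
  have h_indep : iIndepFun (fun i (u : ∀ i, E i) => f i (u i)) (Measure.pi μ) :=
    iIndepFun_pi fun i => (hf i).aemeasurable
  rw [lintegral_prod_eq_prod_lintegral_of_indepFun Finset.univ _ h_indep
    fun i => (hf i).comp (measurable_pi_apply i)]
  exact Finset.prod_congr rfl fun i _ => (measurePreserving_eval μ i).lintegral_comp (hf i)

theorem lintegral_prod_comp_of_iIndepFun {Ω : Type*} [MeasurableSpace Ω] {P : Measure Ω}
    {X : ∀ i, Ω → E i} (hX : ∀ i, AEMeasurable (X i) P) (h_indep : iIndepFun X P)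
    {f : ∀ i, E i → ENNReal} (hf : ∀ i, Measurable (f i)) :
    ∫⁻ ω, ∏ i, f i (X i ω) ∂P = ∏ i, ∫⁻ ω, f i (X i ω) ∂P := by
  have := h_indep.isProbabilityMeasure
  have (i : ι) := Measure.isProbabilityMeasure_map (hX i)
  calc ∫⁻ ω, ∏ i, f i (X i ω) ∂P = ∫⁻ u, ∏ i, f i (u i) ∂Measure.pi fun i => P.map (X i) := by
        rw [← h_indep.map_fun_eq_pi_map hX,
          lintegral_map' (Measurable.aemeasurable (by fun_prop)) (aemeasurable_pi_lambda _ hX)]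
    _ = ∏ i, ∫⁻ ω, f i (X i ω) ∂P := by
        rw [lintegral_pi_prod _ hf]
        exact Finset.prod_congr rfl fun i _ => lintegral_map' (hf i).aemeasurable (hX i)

theorem pi_withDensity {f : ∀ i, E i → ENNReal} (hf : ∀ i, Measurable (f i))
    [∀ i, SigmaFinite ((μ i).withDensity (f i))] :
    Measure.pi (fun i => (μ i).withDensity (f i)) =
      (Measure.pi μ).withDensity fun u => ∏ i, f i (u i) := by
  refine Measure.pi_eq fun s hs => ?_
  have h_indicator (u : ∀ i, E i) : (Set.univ.pi s).indicator (fun u => ∏ i, f i (u i)) u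
      = ∏ i, (s i).indicator (f i) (u i) := by
    classical
    by_cases hu : u ∈ Set.univ.pi s
    · rw [Set.indicator_of_mem hu]
      exact Finset.prod_congr rfl fun i _ => (Set.indicator_of_mem (hu i trivial) _).symm
    · obtain ⟨i, hi⟩ : ∃ i, u i ∉ s i := by simpa only [Set.mem_univ_pi, not_forall] using hu
      rw [Set.indicator_of_notMem hu]
      exact (Finset.prod_eq_zero (Finset.mem_univ i) (Set.indicator_of_notMem hi _)).symm
  simp_rw [withDensity_apply _ (.univ_pi hs), ← lintegral_indicator (.univ_pi hs), h_indicator,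
    lintegral_pi_prod μ fun i => (hf i).indicator (hs i), lintegral_indicator (hs _),
    withDensity_apply _ (hs _)]

theorem integrable_mul_eval_pi {i j : ι} (hij : i ≠ j) {f : E i → ℝ} {g : E j → ℝ}
    (hf : Integrable f (μ i)) (hg : Integrable g (μ j)) (hfm : Measurable f) (hgm : Measurable g) :
    Integrable (fun u : ∀ i, E i => f (u i) * g (u j)) (Measure.pi μ) :=
  (((iIndepFun_pi (μ := μ) (X := fun _ a => a) fun _ => aemeasurable_id).indepFun hij).comp
    hfm hgm).integrable_mul (integrable_comp_eval hf) (integrable_comp_eval hg)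

theorem integral_mul_eval_pi {i j : ι} (hij : i ≠ j) {f : E i → ℝ} {g : E j → ℝ}
    (hfm : Measurable f) (hgm : Measurable g) :
    ∫ u : ∀ i, E i, f (u i) * g (u j) ∂Measure.pi μ = (∫ a, f a ∂μ i) * ∫ b, g b ∂μ j := by
  have h_indep := ((iIndepFun_pi (μ := μ) (X := fun _ a => a)
    fun _ => aemeasurable_id).indepFun hij).comp hfm hgm
  rw [← integral_comp_eval (μ := μ) hfm.aestronglyMeasurable,
    ← integral_comp_eval (μ := μ) hgm.aestronglyMeasurable]
  exact h_indep.integral_fun_mul_eq_mul_integral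
    (hfm.comp (measurable_pi_apply i)).aestronglyMeasurable
    (hgm.comp (measurable_pi_apply j)).aestronglyMeasurable

end ProductMeasures

section GaussianChangeOfMeasure

theorem integrable_id_gaussianReal (z : ℝ) (v : ℝ≥0) :
    Integrable (fun a => a) (gaussianReal z v) :=
  (memLp_id_gaussianReal (μ := z) (v := v) 1).integrable (by simp)

theorem integrable_sq_gaussianReal (z : ℝ) (v : ℝ≥0) :
    Integrable (fun a => a ^ 2) (gaussianReal z v) :=
  (memLp_id_gaussianReal (μ := z) (v := v) 2).integrable_sq

theorem integral_sq_gaussianReal (z : ℝ) (v : ℝ≥0) :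
    ∫ a, a ^ 2 ∂gaussianReal z v = z ^ 2 + v := by
  have h_variance := variance_eq_sub (memLp_id_gaussianReal (μ := z) (v := v) 2)
  simp only [variance_id_gaussianReal, id_eq, integral_id_gaussianReal, Pi.pow_apply] at h_variance
  linarith

theorem gaussianReal_eq_withDensity_gaussianReal (z z' : ℝ) {v : ℝ≥0} (hv : v ≠ 0) :
    gaussianReal z' v = (gaussianReal z v).withDensity fun a =>
      ENNReal.ofReal (Real.exp ((z' - z) * a / v + (z ^ 2 - z' ^ 2) / (2 * v))) := by
  have hv' : (v : ℝ) ≠ 0 := by exact_mod_cast hv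
  rw [gaussianReal_of_var_ne_zero z' hv, gaussianReal_of_var_ne_zero z hv,
    ← withDensity_mul _ (by fun_prop) (by fun_prop)]
  congr 1
  ext a
  simp only [Pi.mul_apply, gaussianPDF, gaussianPDFReal]
  rw [← ENNReal.ofReal_mul (by positivity), mul_assoc _ (Real.exp _), ← Real.exp_add]
  congr 3
  field_simp
  ring

variable {ι : Type*} [Fintype ι] (z z' : ι → ℝ) {v : ℝ≥0}

theorem pi_gaussianReal_eq_withDensity_pi_gaussianReal (hv : v ≠ 0) :
    Measure.pi (fun i => gaussianReal (z' i) v) =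
      (Measure.pi fun i => gaussianReal (z i) v).withDensity fun u =>
        ENNReal.ofReal (Real.exp
          (∑ i, ((z' i - z i) * u i / v + (z i ^ 2 - z' i ^ 2) / (2 * v)))) := by
  have (i : ι) : SigmaFinite ((gaussianReal (z i) v).withDensity fun a => ENNReal.ofReal
      (Real.exp ((z' i - z i) * a / v + (z i ^ 2 - z' i ^ 2) / (2 * v)))) := by
    rw [← gaussianReal_eq_withDensity_gaussianReal (z i) (z' i) hv]
    infer_instance
  rw [funext fun i => gaussianReal_eq_withDensity_gaussianReal (z i) (z' i) hv,
    pi_withDensity (fun i => gaussianReal (z i) v) fun i => by fun_prop]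
  simp_rw [Real.exp_sum, ENNReal.ofReal_prod_of_nonneg fun _ _ => (Real.exp_pos _).le]

theorem ofReal_one_add_integral_le_lintegral_exp {α : Type*} [MeasurableSpace α] {μ : Measure α}
    [IsProbabilityMeasure μ] {f : α → ℝ} (hf : Integrable f μ) :
    ENNReal.ofReal (1 + ∫ a, f a ∂μ) ≤ ∫⁻ a, ENNReal.ofReal (Real.exp (f a)) ∂μ := by
  have h_add : 1 + ∫ a, f a ∂μ = ∫ a, (f a + 1) ∂μ := by
    rw [integral_add hf (integrable_const 1), integral_const, probReal_univ, one_smul, add_comm]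
  have h_integrable : Integrable (fun a => f a + 1) μ := hf.add (integrable_const 1)
  calc ENNReal.ofReal (1 + ∫ a, f a ∂μ) ≤ ∫⁻ a, ENNReal.ofReal (f a + 1) ∂μ := by
        rw [h_add, integral_eq_lintegral_pos_part_sub_lintegral_neg_part h_integrable]
        exact ENNReal.ofReal_le_of_le_toReal (sub_le_self _ ENNReal.toReal_nonneg)
    _ ≤ ∫⁻ a, ENNReal.ofReal (Real.exp (f a)) ∂μ :=
        lintegral_mono fun a => ENNReal.ofReal_le_ofReal (Real.add_one_le_exp _)

theorem ofReal_le_lintegral_exp_pi_gaussianReal (hv : v ≠ 0) {f : (ι → ℝ) → ℝ}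
    (hfm : Measurable f) (hf : Integrable f (Measure.pi fun i => gaussianReal (z i) v)) :
    ENNReal.ofReal (1 + ∫ u, f u ∂(Measure.pi fun i => gaussianReal (z i) v)
        - ∑ i, (z i - z' i) ^ 2 / (2 * v))
      ≤ ∫⁻ u, ENNReal.ofReal (Real.exp (f u)) ∂(Measure.pi fun i => gaussianReal (z' i) v) := by
  set ρ := Measure.pi fun i => gaussianReal (z i) v
  let logDensity (i : ι) (u : ι → ℝ) : ℝ :=
    (z' i - z i) * u i / v + (z i ^ 2 - z' i ^ 2) / (2 * v)
  have h_linear (i : ι) : Integrable (fun u : ι → ℝ => (z' i - z i) * u i / v) ρ :=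
    ((integrable_eval (integrable_id_gaussianReal (z i) v)).const_mul _).div_const _
  have h_term (i : ι) : Integrable (logDensity i) ρ := (h_linear i).add (integrable_const _)
  have h_sum : Integrable (fun u => ∑ i, logDensity i u) ρ :=
    integrable_finsetSum _ fun i _ => h_term i
  have h_entropy : ∫ u, ∑ i, logDensity i u ∂ρ = -∑ i, (z i - z' i) ^ 2 / (2 * v) := by
    rw [integral_finsetSum _ fun i _ => h_term i, ← Finset.sum_neg_distrib]
    refine Finset.sum_congr rfl fun i _ => ?_
    rw [integral_add (h_linear i) (integrable_const _), integral_div, integral_const_mul,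
      integral_eval, integral_id_gaussianReal, integral_const, probReal_univ, one_smul]
    have hv' : (v : ℝ) ≠ 0 := by exact_mod_cast hv
    field_simp
    ring
  calc _ = ENNReal.ofReal (1 + ∫ u, (f u + ∑ i, logDensity i u) ∂ρ) := by
        rw [integral_add hf h_sum, h_entropy, ← sub_eq_add_neg, add_sub_assoc]
    _ ≤ ∫⁻ u, ENNReal.ofReal (Real.exp (f u + ∑ i, logDensity i u)) ∂ρ :=
        ofReal_one_add_integral_le_lintegral_exp (hf.add h_sum)
    _ = _ := by
        rw [pi_gaussianReal_eq_withDensity_pi_gaussianReal z z' hv,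
          lintegral_withDensity_eq_lintegral_mul _ (by fun_prop) (by fun_prop)]
        refine lintegral_congr fun u => ?_
        rw [Pi.mul_apply, ← ENNReal.ofReal_mul (Real.exp_pos _).le, ← Real.exp_add, add_comm]

end GaussianChangeOfMeasure

section PenalizedForm

variable {ι κ : Type*} [Fintype ι] [Fintype κ]

/-- The bilinear form of `X` at the pair of vectors `w = (x, y)`, minus half of the variance
`∑ V i j * (x i * y j) ^ 2` it has when the entries of `X` are independent with variances `V`. -/
noncomputable def penalizedForm (X V : Matrix ι κ ℝ) (w : ι ⊕ κ → ℝ) : ℝ :=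
  ∑ e : ι × κ, (X e.1 e.2 * (w (.inl e.1) * w (.inr e.2))
    - V e.1 e.2 / 2 * (w (.inl e.1) * w (.inr e.2)) ^ 2)

theorem measurable_penalizedForm (X V : Matrix ι κ ℝ) : Measurable (penalizedForm X V) := by
  unfold penalizedForm
  fun_prop

section Gaussian

variable (X V : Matrix ι κ ℝ) (z : ι ⊕ κ → ℝ) (v : ℝ≥0)

theorem integrable_mul_pi_gaussianReal (e : ι × κ) :
    Integrable (fun w : ι ⊕ κ → ℝ => w (.inl e.1) * w (.inr e.2))
      (Measure.pi fun i => gaussianReal (z i) v) :=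
  integrable_mul_eval_pi (fun i => gaussianReal (z i) v) Sum.inl_ne_inr
    (integrable_id_gaussianReal _ _) (integrable_id_gaussianReal _ _) measurable_id measurable_id

theorem integrable_sq_mul_pi_gaussianReal (e : ι × κ) :
    Integrable (fun w : ι ⊕ κ → ℝ => (w (.inl e.1) * w (.inr e.2)) ^ 2)
      (Measure.pi fun i => gaussianReal (z i) v) := by
  simp_rw [mul_pow]
  exact integrable_mul_eval_pi (fun i => gaussianReal (z i) v) Sum.inl_ne_inr
    (integrable_sq_gaussianReal _ _) (integrable_sq_gaussianReal _ _)
    (measurable_id.pow_const 2) (measurable_id.pow_const 2)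

theorem integral_mul_pi_gaussianReal (e : ι × κ) :
    ∫ w : ι ⊕ κ → ℝ, w (.inl e.1) * w (.inr e.2) ∂(Measure.pi fun i => gaussianReal (z i) v) =
      z (.inl e.1) * z (.inr e.2) :=
  (integral_mul_eval_pi (fun i => gaussianReal (z i) v) Sum.inl_ne_inr measurable_id
    measurable_id).trans (by simp only [id_eq, integral_id_gaussianReal])

theorem integral_sq_mul_pi_gaussianReal (e : ι × κ) :
    ∫ w : ι ⊕ κ → ℝ, (w (.inl e.1) * w (.inr e.2)) ^ 2
        ∂(Measure.pi fun i => gaussianReal (z i) v) =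
      (z (.inl e.1) ^ 2 + v) * (z (.inr e.2) ^ 2 + v) := by
  simp_rw [mul_pow]
  exact (integral_mul_eval_pi (fun i => gaussianReal (z i) v) Sum.inl_ne_inr
    (measurable_id.pow_const 2) (measurable_id.pow_const 2)).trans
    (by simp only [id_eq, integral_sq_gaussianReal])

theorem integrable_penalizedForm :
    Integrable (penalizedForm X V) (Measure.pi fun i => gaussianReal (z i) v) :=
  integrable_finsetSum _ fun e _ => ((integrable_mul_pi_gaussianReal z v e).const_mul _).sub
    ((integrable_sq_mul_pi_gaussianReal z v e).const_mul _)

theorem integral_penalizedForm :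
    ∫ w, penalizedForm X V w ∂(Measure.pi fun i => gaussianReal (z i) v) =
      ∑ e : ι × κ, X e.1 e.2 * (z (.inl e.1) * z (.inr e.2))
        - (∑ e : ι × κ, V e.1 e.2 * ((z (.inl e.1) ^ 2 + v) * (z (.inr e.2) ^ 2 + v))) / 2 := by
  have h_mul (e : ι × κ) := (integrable_mul_pi_gaussianReal z v e).const_mul (X e.1 e.2)
  have h_sq (e : ι × κ) := (integrable_sq_mul_pi_gaussianReal z v e).const_mul (V e.1 e.2 / 2)
  unfold penalizedForm
  rw [integral_finsetSum, Finset.sum_div, ← Finset.sum_sub_distrib]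
  swap
  · exact fun e _ => (h_mul e).sub (h_sq e)
  refine Finset.sum_congr rfl fun e _ => ?_
  rw [integral_sub (h_mul e) (h_sq e), integral_const_mul, integral_const_mul,
    integral_mul_pi_gaussianReal, integral_sq_mul_pi_gaussianReal, div_mul_eq_mul_div]

end Gaussian

theorem sum_mul_row_le {V : Matrix ι κ ℝ} {x : ι → ℝ} (hx : ∑ i, x i ^ 2 ≤ 1) {R : ℝ}
    (hR₀ : 0 ≤ R) (hR : ∀ i, ∑ j, V i j ≤ R) : ∑ e : ι × κ, V e.1 e.2 * x e.1 ^ 2 ≤ R :=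
  calc ∑ e : ι × κ, V e.1 e.2 * x e.1 ^ 2 = ∑ i, (∑ j, V i j) * x i ^ 2 := by
        simp only [Fintype.sum_prod_type, Finset.sum_mul]
    _ ≤ ∑ i, R * x i ^ 2 :=
        Finset.sum_le_sum fun i _ => mul_le_mul_of_nonneg_right (hR i) (sq_nonneg _)
    _ = R * ∑ i, x i ^ 2 := (Finset.mul_sum _ _ _).symm
    _ ≤ R := mul_le_of_le_one_right hR₀ hx

theorem sum_mul_col_le {V : Matrix ι κ ℝ} {y : κ → ℝ} (hy : ∑ j, y j ^ 2 ≤ 1) {K : ℝ}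
    (hK₀ : 0 ≤ K) (hK : ∀ j, ∑ i, V i j ≤ K) : ∑ e : ι × κ, V e.1 e.2 * y e.2 ^ 2 ≤ K := by
  rw [← (Equiv.prodComm κ ι).sum_comp]
  exact sum_mul_row_le (V := V.transpose) hy hK₀ hK

theorem sum_mul_sq_mul_sq_le {V : Matrix ι κ ℝ} {s : ℝ} (hs : 0 ≤ s) (hV : ∀ i j, V i j ≤ s)
    {x : ι → ℝ} (hx : ∑ i, x i ^ 2 ≤ 1) {y : κ → ℝ} (hy : ∑ j, y j ^ 2 ≤ 1) :
    ∑ e : ι × κ, V e.1 e.2 * (x e.1 ^ 2 * y e.2 ^ 2) ≤ s :=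
  calc ∑ e : ι × κ, V e.1 e.2 * (x e.1 ^ 2 * y e.2 ^ 2)
      ≤ ∑ e : ι × κ, s * (x e.1 ^ 2 * y e.2 ^ 2) := by gcongr; exact hV _ _
    _ = s * ((∑ i, x i ^ 2) * ∑ j, y j ^ 2) := by
        rw [← Finset.mul_sum, Fintype.sum_prod_type, Finset.sum_mul_sum]
    _ ≤ s := mul_le_of_le_one_right hs
        (mul_le_one₀ hx (Finset.sum_nonneg fun j _ => sq_nonneg _) hy)

theorem sum_mul_sq_add_mul_sq_add_le {V : Matrix ι κ ℝ} {s : ℝ} (hs : 0 ≤ s)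
    (hV : ∀ i j, V i j ≤ s) {R K : ℝ} (hR₀ : 0 ≤ R) (hK₀ : 0 ≤ K) (hR : ∀ i, ∑ j, V i j ≤ R)
    (hK : ∀ j, ∑ i, V i j ≤ K) {x : ι → ℝ} (hx : ∑ i, x i ^ 2 ≤ 1) {y : κ → ℝ}
    (hy : ∑ j, y j ^ 2 ≤ 1) {v : ℝ} (hv : 0 ≤ v) :
    ∑ e : ι × κ, V e.1 e.2 * ((x e.1 ^ 2 + v) * (y e.2 ^ 2 + v))
      ≤ s + v * (R + K) + v ^ 2 * ∑ e : ι × κ, V e.1 e.2 :=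
  calc ∑ e : ι × κ, V e.1 e.2 * ((x e.1 ^ 2 + v) * (y e.2 ^ 2 + v))
      = ∑ e : ι × κ, V e.1 e.2 * (x e.1 ^ 2 * y e.2 ^ 2)
        + v * (∑ e : ι × κ, V e.1 e.2 * x e.1 ^ 2 + ∑ e : ι × κ, V e.1 e.2 * y e.2 ^ 2)
        + v ^ 2 * ∑ e : ι × κ, V e.1 e.2 := by
        simp only [Finset.mul_sum, ← Finset.sum_add_distrib]
        exact Finset.sum_congr rfl fun e _ => by ring
    _ ≤ s + v * (R + K) + v ^ 2 * ∑ e : ι × κ, V e.1 e.2 := by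
        gcongr
        · exact sum_mul_sq_mul_sq_le hs hV hx hy
        · exact sum_mul_row_le hx hR₀ hR
        · exact sum_mul_col_le hy hK₀ hK

end PenalizedForm

section SpectralNorm

open scoped Matrix.Norms.L2Operator

variable {ι κ : Type*} [Fintype ι] [Fintype κ] [DecidableEq κ]

theorem l2_opNorm_le_of_bilin_le (X : Matrix ι κ ℝ) {c : ℝ}
    (h : ∀ (x : ι → ℝ) (y : κ → ℝ), ∑ i, x i ^ 2 ≤ 1 → ∑ j, y j ^ 2 ≤ 1 →
      ∑ e : ι × κ, X e.1 e.2 * (x e.1 * y e.2) ≤ c) :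
    ‖X‖ ≤ c := by
  have hc : 0 ≤ c := by simpa using h 0 0
  rw [Matrix.l2_opNorm_def]
  refine ContinuousLinearMap.opNorm_le_of_re_inner_le (𝕜 := ℝ) hc fun y x hy hx => ?_
  have hx' : ∑ i, x i ^ 2 ≤ 1 := by rw [← EuclideanSpace.real_norm_sq_eq, hx, one_pow]
  have hy' : ∑ j, y j ^ 2 ≤ 1 := by rw [← EuclideanSpace.real_norm_sq_eq, hy, one_pow]
  refine le_trans (le_of_eq ?_) (h x y hx' hy')
  rw [Fintype.sum_prod_type]
  simp [PiLp.inner_apply, Matrix.mulVec, dotProduct, Finset.mul_sum, mul_comm, mul_assoc]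

theorem ofReal_one_add_l2_opNorm_le {X V : Matrix ι κ ℝ} {s : ℝ} (hV₀ : ∀ i j, 0 ≤ V i j)
    (hs : 0 ≤ s) (hV : ∀ i j, V i j ≤ s) {R K : ℝ} (hR₀ : 0 ≤ R) (hK₀ : 0 ≤ K)
    (hR : ∀ i, ∑ j, V i j ≤ R) (hK : ∀ j, ∑ i, V i j ≤ K) {v : ℝ≥0} (hv : v ≠ 0) :
    ENNReal.ofReal (1 + ‖X‖) ≤
      ∫⁻ w, ENNReal.ofReal (Real.exp (penalizedForm X V w)) ∂(Measure.pi fun _ => gaussianReal 0 v)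
        + ENNReal.ofReal (1 / v + (s + v * (R + K) + v ^ 2 * ∑ e : ι × κ, V e.1 e.2) / 2) := by
  set Z := ∫⁻ w, ENNReal.ofReal (Real.exp (penalizedForm X V w))
    ∂(Measure.pi fun _ => gaussianReal 0 v)
  set B := 1 / v + (s + v * (R + K) + v ^ 2 * ∑ e : ι × κ, V e.1 e.2) / 2 with hB_def
  rcases eq_or_ne Z ⊤ with hZ | hZ
  · simp [hZ]
  have hB : 0 ≤ B := by
    have : 0 ≤ ∑ e : ι × κ, V e.1 e.2 := Finset.sum_nonneg fun e _ => hV₀ _ _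
    positivity
  have h_bilin (x : ι → ℝ) (y : κ → ℝ) (hx : ∑ i, x i ^ 2 ≤ 1) (hy : ∑ j, y j ^ 2 ≤ 1) :
      ∑ e : ι × κ, X e.1 e.2 * (x e.1 * y e.2) ≤ Z.toReal + B - 1 := by
    have h_variational := ofReal_le_lintegral_exp_pi_gaussianReal (Sum.elim x y) 0 hv
      (measurable_penalizedForm X V) (integrable_penalizedForm X V _ v)
    have h_cost : (∑ i, x i ^ 2 + ∑ j, y j ^ 2) / (2 * (v : ℝ)) ≤ 1 / v := by
      calc _ ≤ (1 + 1) / (2 * (v : ℝ)) := by gcongr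
        _ = 1 / v := by rw [one_add_one_eq_two, div_mul_cancel_left₀ two_ne_zero, one_div]
    have h_penalty := sum_mul_sq_add_mul_sq_add_le hs hV hR₀ hK₀ hR hK hx hy v.coe_nonneg
    simp only [integral_penalizedForm, Pi.zero_apply, sub_zero, Sum.elim_inl, Sum.elim_inr,
      Fintype.sum_sum_type, ← Finset.sum_div] at h_variational
    linarith [(ENNReal.ofReal_le_iff_le_toReal hZ).1 h_variational]
  calc ENNReal.ofReal (1 + ‖X‖) ≤ ENNReal.ofReal (Z.toReal + B) :=
        ENNReal.ofReal_le_ofReal (by linarith [l2_opNorm_le_of_bilin_le X h_bilin])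
    _ = Z + ENNReal.ofReal B := by
        rw [ENNReal.ofReal_add ENNReal.toReal_nonneg hB, ENNReal.ofReal_toReal hZ]

end SpectralNorm

section Majorant

variable {Ω : Type*} [MeasurableSpace Ω] {P : Measure Ω}

theorem memLp_two_sqrt {D : Ω → ℝ} (hD : Integrable D P) (hD₀ : 0 ≤ D) :
    MemLp (fun ω => √(D ω)) 2 P := by
  rw [memLp_two_iff_integrable_sq
    (Real.continuous_sqrt.comp_aestronglyMeasurable hD.aestronglyMeasurable)]
  simpa only [Real.sq_sqrt (hD₀ _)] using hD

variable [IsProbabilityMeasure P]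

theorem integral_sqrt_le_sqrt_integral {D : Ω → ℝ} (hD : Integrable D P) (hD₀ : 0 ≤ D) :
    ∫ ω, √(D ω) ∂P ≤ √(∫ ω, D ω ∂P) := by
  refine Real.le_sqrt_of_sq_le ?_
  have h_variance := variance_nonneg (fun ω => √(D ω)) P
  rw [variance_eq_sub (memLp_two_sqrt hD hD₀)] at h_variance
  simpa only [Pi.pow_apply, Real.sq_sqrt (hD₀ _), sub_nonneg] using h_variance

variable {ι κ : Type*} [Fintype ι] [Fintype κ]

theorem exists_majorant {S : ι → Ω → ℝ} (hS : ∀ i, MemLp (S i) 2 P) {R : ℝ} (hR₀ : 0 ≤ R)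
    (hR : ∀ i, P[S i] ≤ R) :
    ∃ M : Ω → ℝ, Integrable M P ∧ 0 ≤ M ∧ (∀ i ω, S i ω ≤ M ω) ∧
      P[M] ≤ R + √(∑ i, Var[S i; P]) := by
  let D (ω : Ω) : ℝ := ∑ i, (S i ω - P[S i]) ^ 2
  have h_sq (i : ι) : Integrable (fun ω => (S i ω - P[S i]) ^ 2) P :=
    ((hS i).sub (memLp_const _)).integrable_sq
  have hD : Integrable D P := integrable_finsetSum _ fun i _ => h_sq i
  have hD₀ : 0 ≤ D := fun ω => Finset.sum_nonneg fun i _ => sq_nonneg _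
  have h_sqrt : Integrable (fun ω => √(D ω)) P := (memLp_two_sqrt hD hD₀).integrable one_le_two
  refine ⟨fun ω => R + √(D ω), (integrable_const R).add h_sqrt,
    fun ω => add_nonneg hR₀ (Real.sqrt_nonneg _), fun i ω => ?_, ?_⟩
  · have h_deviation : S i ω - P[S i] ≤ √(D ω) := Real.le_sqrt_of_sq_le <|
      Finset.single_le_sum (f := fun i => (S i ω - P[S i]) ^ 2) (fun i _ => sq_nonneg _)
        (Finset.mem_univ i)
    linarith [hR i]
  · rw [integral_add (integrable_const R) h_sqrt, integral_const, probReal_univ, one_smul]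
    have hD_integral : ∫ ω, D ω ∂P = ∑ i, Var[S i; P] := by
      rw [integral_finsetSum _ fun i _ => h_sq i]
      exact Finset.sum_congr rfl fun i _ => (variance_eq_integral (hS i).aemeasurable).symm
    grw [integral_sqrt_le_sqrt_integral hD hD₀, hD_integral]

theorem variance_le_mul_integral_of_mem_Icc {Y : Ω → ℝ} (hY : AEMeasurable Y P) {s : ℝ}
    (hYs : ∀ ω, Y ω ∈ Set.Icc 0 s) : Var[Y; P] ≤ s * P[Y] := by
  have hY₂ : MemLp Y 2 P := memLp_of_bounded (.of_forall hYs) hY.aestronglyMeasurable 2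
  calc Var[Y; P] ≤ P[Y ^ 2] := variance_le_expectation_sq hY.aestronglyMeasurable
    _ ≤ ∫ ω, s * Y ω ∂P := by
        refine integral_mono hY₂.integrable_sq ((hY₂.integrable one_le_two).const_mul s) fun ω => ?_
        simp only [Pi.pow_apply, sq]
        exact mul_le_mul_of_nonneg_right (hYs ω).2 (hYs ω).1
    _ = s * P[Y] := integral_const_mul _ _

theorem exists_rowSum_majorant {V : Ω → Matrix ι κ ℝ} (hV : ∀ i j, AEMeasurable (V · i j) P)
    (h_indep : ∀ i, Pairwise fun j j' => IndepFun (V · i j) (V · i j') P) {s : ℝ}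
    (hVs : ∀ ω i j, V ω i j ∈ Set.Icc 0 s) {R N : ℝ} (hR₀ : 0 ≤ R) (hs : 0 ≤ s)
    (hR : ∀ i, ∑ j, ∫ ω, V ω i j ∂P ≤ R) (hN : ∑ i, ∑ j, ∫ ω, V ω i j ∂P ≤ N) :
    ∃ M : Ω → ℝ, Integrable M P ∧ 0 ≤ M ∧ (∀ i ω, ∑ j, V ω i j ≤ M ω) ∧
      P[M] ≤ R + √(s * N) := by
  have hV₂ (i : ι) (j : κ) : MemLp (V · i j) 2 P :=
    memLp_of_bounded (.of_forall (hVs · i j)) (hV i j).aestronglyMeasurable 2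
  have h_mean (i : ι) : ∫ ω, ∑ j, V ω i j ∂P = ∑ j, ∫ ω, V ω i j ∂P :=
    integral_finsetSum _ fun j _ => (hV₂ i j).integrable one_le_two
  have h_variance (i : ι) : Var[fun ω => ∑ j, V ω i j; P] ≤ s * ∑ j, ∫ ω, V ω i j ∂P := by
    have h_sum : (fun ω => ∑ j, V ω i j) = ∑ j, (V · i j) := by ext ω; simp
    rw [h_sum, IndepFun.variance_sum (fun j _ => hV₂ i j) fun j _ j' _ hjj' => h_indep i hjj',
      Finset.mul_sum]
    exact Finset.sum_le_sum fun j _ => variance_le_mul_integral_of_mem_Icc (hV i j) (hVs · i j)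
  obtain ⟨M, hM, hM₀, hM_major, hM_mean⟩ := exists_majorant (S := fun i ω => ∑ j, V ω i j)
    (fun i => memLp_finsetSum _ fun j _ => hV₂ i j) hR₀ fun i => (h_mean i).trans_le (hR i)
  refine ⟨M, hM, hM₀, hM_major, hM_mean.trans ?_⟩
  gcongr
  calc ∑ i, Var[fun ω => ∑ j, V ω i j; P] ≤ s * ∑ i, ∑ j, ∫ ω, V ω i j ∂P := by
        rw [Finset.mul_sum]
        exact Finset.sum_le_sum fun i _ => h_variance i
    _ ≤ s * N := by gcongr

end Majorant

section RandomMatrix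

open scoped Matrix.Norms.L2Operator

variable {Ω : Type*} [MeasurableSpace Ω] {P : Measure Ω}

/-- `V` is a random variance proxy for `X`: the canonical assumption of the theory of
self-normalised processes. A Gaussian variable of variance `s` which is sometimes replaced by `0`
has the proxy `s` where it is kept and `0` where it is erased. -/
def HasVarianceProxy (X V : Ω → ℝ) (P : Measure Ω) : Prop :=
  ∀ t : ℝ, ∫⁻ ω, ENNReal.ofReal (Real.exp (t * X ω - t ^ 2 / 2 * V ω)) ∂P ≤ 1

theorem HasVarianceProxy.const_mul {X V : Ω → ℝ} (h : HasVarianceProxy X V P) (c : ℝ) :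
    HasVarianceProxy (fun ω => c * X ω) (fun ω => c ^ 2 * V ω) P := by
  intro t
  simpa only [mul_pow, mul_assoc, mul_div_right_comm] using h (t * c)

variable {ι κ : Type*} [Fintype ι] [Fintype κ] {X V : Ω → Matrix ι κ ℝ}

theorem lintegral_exp_penalizedForm_le_one (hX : ∀ i j, AEMeasurable (X · i j) P)
    (hV : ∀ i j, AEMeasurable (V · i j) P)
    (h_indep : iIndepFun (fun (e : ι × κ) ω => (X ω e.1 e.2, V ω e.1 e.2)) P)
    (h_proxy : ∀ i j, HasVarianceProxy (X · i j) (V · i j) P) (w : ι ⊕ κ → ℝ) :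
    ∫⁻ ω, ENNReal.ofReal (Real.exp (penalizedForm (X ω) (V ω) w)) ∂P ≤ 1 := by
  let g (e : ι × κ) (a : ℝ × ℝ) : ENNReal := ENNReal.ofReal (Real.exp
    (w (.inl e.1) * w (.inr e.2) * a.1 - (w (.inl e.1) * w (.inr e.2)) ^ 2 / 2 * a.2))
  have hg (e : ι × κ) : Measurable (g e) := by fun_prop
  calc ∫⁻ ω, ENNReal.ofReal (Real.exp (penalizedForm (X ω) (V ω) w)) ∂P
      = ∫⁻ ω, ∏ e : ι × κ, g e (X ω e.1 e.2, V ω e.1 e.2) ∂P := by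
        refine lintegral_congr fun ω => ?_
        rw [penalizedForm, Real.exp_sum,
          ENNReal.ofReal_prod_of_nonneg fun e _ => (Real.exp_pos _).le]
        refine Finset.prod_congr rfl fun e _ => congrArg (fun a => ENNReal.ofReal (Real.exp a)) ?_
        ring
    _ = ∏ e : ι × κ, ∫⁻ ω, g e (X ω e.1 e.2, V ω e.1 e.2) ∂P :=
        lintegral_prod_comp_of_iIndepFun (fun e => (hX e.1 e.2).prodMk (hV e.1 e.2)) h_indep hg
    _ ≤ 1 := Finset.prod_le_one' fun e _ => h_proxy e.1 e.2 _

variable [IsProbabilityMeasure P]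

theorem lintegral_lintegral_exp_penalizedForm_le_one (hX : ∀ i j, AEMeasurable (X · i j) P)
    (hV : ∀ i j, AEMeasurable (V · i j) P)
    (h_indep : iIndepFun (fun (e : ι × κ) ω => (X ω e.1 e.2, V ω e.1 e.2)) P)
    (h_proxy : ∀ i j, HasVarianceProxy (X · i j) (V · i j) P)
    (ρ : Measure (ι ⊕ κ → ℝ)) [IsProbabilityMeasure ρ] :
    ∫⁻ ω, ∫⁻ w, ENNReal.ofReal (Real.exp (penalizedForm (X ω) (V ω) w)) ∂ρ ∂P ≤ 1 := by
  have (e : ι × κ) : AEMeasurable (fun p : Ω × (ι ⊕ κ → ℝ) => X p.1 e.1 e.2) (P.prod ρ) :=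
    (hX _ _).comp_fst
  have (e : ι × κ) : AEMeasurable (fun p : Ω × (ι ⊕ κ → ℝ) => V p.1 e.1 e.2) (P.prod ρ) :=
    (hV _ _).comp_fst
  rw [lintegral_lintegral_swap (by unfold Function.uncurry penalizedForm; fun_prop)]
  calc _ ≤ ∫⁻ _, 1 ∂ρ :=
        lintegral_mono fun w => lintegral_exp_penalizedForm_le_one hX hV h_indep h_proxy w
    _ = 1 := by rw [lintegral_one, measure_univ]

variable [DecidableEq κ]

theorem lintegral_l2_opNorm_le_lintegral (hX : ∀ i j, AEMeasurable (X · i j) P)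
    (hV : ∀ i j, AEMeasurable (V · i j) P)
    (h_indep : iIndepFun (fun (e : ι × κ) ω => (X ω e.1 e.2, V ω e.1 e.2)) P)
    (h_proxy : ∀ i j, HasVarianceProxy (X · i j) (V · i j) P) {s : ℝ} (hs : 0 ≤ s)
    (hVs : ∀ ω i j, V ω i j ∈ Set.Icc 0 s) {R K : Ω → ℝ} (hRm : AEMeasurable R P)
    (hKm : AEMeasurable K P) (hR₀ : 0 ≤ R) (hK₀ : 0 ≤ K)
    (hR : ∀ i ω, ∑ j, V ω i j ≤ R ω) (hK : ∀ j ω, ∑ i, V ω i j ≤ K ω) {v : ℝ≥0} (hv : v ≠ 0) :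
    ∫⁻ ω, ENNReal.ofReal ‖X ω‖ ∂P ≤ ∫⁻ ω, ENNReal.ofReal
      (1 / v + (s + v * (R ω + K ω) + v ^ 2 * ∑ e : ι × κ, V ω e.1 e.2) / 2) ∂P := by
  refine (ENNReal.add_le_add_iff_left ENNReal.one_ne_top).1 ?_
  calc 1 + ∫⁻ ω, ENNReal.ofReal ‖X ω‖ ∂P = ∫⁻ ω, ENNReal.ofReal (1 + ‖X ω‖) ∂P := by
        simp_rw [ENNReal.ofReal_add zero_le_one (norm_nonneg _)]
        rw [lintegral_add_left measurable_const, lintegral_const, measure_univ, mul_one,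
          ENNReal.ofReal_one]
    _ ≤ ∫⁻ ω, (∫⁻ w, ENNReal.ofReal (Real.exp (penalizedForm (X ω) (V ω) w))
          ∂(Measure.pi fun _ => gaussianReal 0 v)) + ENNReal.ofReal
            (1 / v + (s + v * (R ω + K ω) + v ^ 2 * ∑ e : ι × κ, V ω e.1 e.2) / 2) ∂P :=
        lintegral_mono fun ω => ofReal_one_add_l2_opNorm_le (fun i j => (hVs ω i j).1) hs
          (fun i j => (hVs ω i j).2) (hR₀ ω) (hK₀ ω) (hR · ω) (hK · ω) hv
    _ ≤ _ := by
        rw [lintegral_add_right' _ (by fun_prop)]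
        gcongr
        exact lintegral_lintegral_exp_penalizedForm_le_one hX hV h_indep h_proxy _

theorem lintegral_l2_opNorm_le_of_var (hX : ∀ i j, AEMeasurable (X · i j) P)
    (hV : ∀ i j, AEMeasurable (V · i j) P)
    (h_indep : iIndepFun (fun (e : ι × κ) ω => (X ω e.1 e.2, V ω e.1 e.2)) P)
    (h_proxy : ∀ i j, HasVarianceProxy (X · i j) (V · i j) P) {s : ℝ} (hs : 0 ≤ s)
    (hVs : ∀ ω i j, V ω i j ∈ Set.Icc 0 s) {R K N : ℝ} (hR₀ : 0 ≤ R) (hK₀ : 0 ≤ K)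
    (hR : ∀ i, ∑ j, ∫ ω, V ω i j ∂P ≤ R) (hK : ∀ j, ∑ i, ∫ ω, V ω i j ∂P ≤ K)
    (hN : ∑ i, ∑ j, ∫ ω, V ω i j ∂P ≤ N) {v : ℝ≥0} (hv : v ≠ 0) :
    ∫⁻ ω, ENNReal.ofReal ‖X ω‖ ∂P ≤ ENNReal.ofReal
      (1 / v + (s + v * (R + K + 2 * √(s * N)) + v ^ 2 * N) / 2) := by
  have h_indepV : iIndepFun (fun (e : ι × κ) ω => V ω e.1 e.2) P :=
    h_indep.comp (fun _ => Prod.snd) fun _ => measurable_snd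
  obtain ⟨MR, hMR, hMR₀, hVR, hMR_mean⟩ := exists_rowSum_majorant hV
    (fun i j j' hjj' => h_indepV.indepFun (i := (i, j)) (j := (i, j')) (by simpa using hjj')) hVs
    hR₀ hs hR hN
  obtain ⟨MK, hMK, hMK₀, hVK, hMK_mean⟩ := exists_rowSum_majorant
    (V := fun ω => (V ω).transpose) (fun j i => hV i j)
    (fun j i i' hii' => h_indepV.indepFun (i := (i, j)) (j := (i', j)) (by simpa using hii'))
    (fun ω j i => hVs ω i j) hK₀ hs hK (Finset.sum_comm.trans_le hN)
  have hV_integrable (e : ι × κ) : Integrable (fun ω => V ω e.1 e.2) P :=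
    (memLp_of_bounded (.of_forall (hVs · e.1 e.2)) (hV e.1 e.2).aestronglyMeasurable
      1).integrable le_rfl
  have h_mean : ∫ ω, (1 / v + (s + v * (MR ω + MK ω) + v ^ 2 * ∑ e : ι × κ, V ω e.1 e.2) / 2) ∂P =
      1 / v + (s + v * (P[MR] + P[MK]) + v ^ 2 * ∑ i, ∑ j, ∫ ω, V ω i j ∂P) / 2 := by
    rw [integral_add (by fun_prop) (by fun_prop), integral_const, integral_div,
      integral_add (by fun_prop) (by fun_prop), integral_add (by fun_prop) (by fun_prop),
      integral_const, integral_const_mul, integral_const_mul, integral_add hMR hMK,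
      integral_finsetSum _ fun e _ => hV_integrable e, Fintype.sum_prod_type]
    simp only [probReal_univ, one_smul]
  refine (lintegral_l2_opNorm_le_lintegral hX hV h_indep h_proxy hs hVs hMR.aemeasurable
    hMK.aemeasurable hMR₀ hMK₀ hVR hVK hv).trans ?_
  rw [← ofReal_integral_eq_lintegral_ofReal (by fun_prop) (.of_forall fun ω => ?_), h_mean]
  · refine ENNReal.ofReal_le_ofReal ?_
    grw [hMR_mean, hMK_mean, hN]
    apply le_of_eq
    ring
  · have h_sum : 0 ≤ ∑ e : ι × κ, V ω e.1 e.2 := Finset.sum_nonneg fun e _ => (hVs ω _ _).1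
    have h_majorants : 0 ≤ MR ω + MK ω := add_nonneg (hMR₀ ω) (hMK₀ ω)
    simp only [Pi.zero_apply]
    positivity

theorem lintegral_l2_opNorm_le_of_scale (hX : ∀ i j, AEMeasurable (X · i j) P)
    (hV : ∀ i j, AEMeasurable (V · i j) P)
    (h_indep : iIndepFun (fun (e : ι × κ) ω => (X ω e.1 e.2, V ω e.1 e.2)) P)
    (h_proxy : ∀ i j, HasVarianceProxy (X · i j) (V · i j) P) {s : ℝ} (hs : 0 ≤ s)
    (hVs : ∀ ω i j, V ω i j ∈ Set.Icc 0 s) {R K N : ℝ} (hR₀ : 0 ≤ R) (hK₀ : 0 ≤ K)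
    (hR : ∀ i, ∑ j, ∫ ω, V ω i j ∂P ≤ R) (hK : ∀ j, ∑ i, ∫ ω, V ω i j ∂P ≤ K)
    (hN : ∑ i, ∑ j, ∫ ω, V ω i j ∂P ≤ N) {v : ℝ≥0} (hv : v ≠ 0) {t : ℝ} (ht : 0 < t) :
    ∫⁻ ω, ENNReal.ofReal ‖X ω‖ ∂P ≤ ENNReal.ofReal
      ((1 / v + t ^ 2 * (s + v * (R + K + 2 * √(s * N)) + v ^ 2 * N) / 2) / t) := by
  have h_indep_scaled :
      iIndepFun (fun (e : ι × κ) ω => ((t • X ω) e.1 e.2, (t ^ 2 • V ω) e.1 e.2)) P :=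
    h_indep.comp (fun _ (a : ℝ × ℝ) => (t • a.1, t ^ 2 • a.2)) fun _ => by fun_prop
  have h_sqrt : √(t ^ 2 * s * (t ^ 2 * N)) = t ^ 2 * √(s * N) := by
    rw [mul_mul_mul_comm, Real.sqrt_mul (by positivity), Real.sqrt_mul_self (by positivity)]
  have h_scaled := lintegral_l2_opNorm_le_of_var (X := fun ω => t • X ω)
    (V := fun ω => t ^ 2 • V ω) (s := t ^ 2 * s) (R := t ^ 2 * R) (K := t ^ 2 * K)
    (N := t ^ 2 * N) (fun i j => (hX i j).const_mul t) (fun i j => (hV i j).const_mul _)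
    h_indep_scaled (fun i j => (h_proxy i j).const_mul t) (by positivity)
    (fun ω i j => ⟨mul_nonneg (by positivity) (hVs ω i j).1,
      mul_le_mul_of_nonneg_left (hVs ω i j).2 (by positivity)⟩)
    (by positivity) (by positivity)
    (fun i => by
      simpa only [Matrix.smul_apply, smul_eq_mul, integral_const_mul, ← Finset.mul_sum]
        using mul_le_mul_of_nonneg_left (hR i) (sq_nonneg t))
    (fun j => by
      simpa only [Matrix.smul_apply, smul_eq_mul, integral_const_mul, ← Finset.mul_sum]
        using mul_le_mul_of_nonneg_left (hK j) (sq_nonneg t))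
    (by simpa only [Matrix.smul_apply, smul_eq_mul, integral_const_mul, ← Finset.mul_sum]
      using mul_le_mul_of_nonneg_left hN (sq_nonneg t)) hv
  simp only [norm_smul, Real.norm_of_nonneg ht.le, ENNReal.ofReal_mul ht.le, h_sqrt] at h_scaled
  rw [lintegral_const_mul' _ _ ENNReal.ofReal_ne_top] at h_scaled
  rw [ENNReal.ofReal_div_of_pos ht, ENNReal.le_div_iff_mul_le (by simp [ht]) (by simp), mul_comm]
  convert h_scaled using 2
  ring

theorem lintegral_l2_opNorm_le (hX : ∀ i j, AEMeasurable (X · i j) P)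
    (hV : ∀ i j, AEMeasurable (V · i j) P)
    (h_indep : iIndepFun (fun (e : ι × κ) ω => (X ω e.1 e.2, V ω e.1 e.2)) P)
    (h_proxy : ∀ i j, HasVarianceProxy (X · i j) (V · i j) P) {s : ℝ} (hs : 0 < s)
    (hVs : ∀ ω i j, V ω i j ∈ Set.Icc 0 s) {R K N : ℝ} (hR₀ : 0 ≤ R) (hK₀ : 0 ≤ K) (hN₀ : 0 < N)
    (hR : ∀ i, ∑ j, ∫ ω, V ω i j ∂P ≤ R) (hK : ∀ j, ∑ i, ∫ ω, V ω i j ∂P ≤ K)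
    (hN : ∑ i, ∑ j, ∫ ω, V ω i j ∂P ≤ N) :
    ∫⁻ ω, ENNReal.ofReal ‖X ω‖ ∂P ≤ ENNReal.ofReal (3 * √(R + K + √(s * N))) := by
  set τ := √(s * N)
  set T := R + K + τ with hT_def
  have hτ : 0 < τ := Real.sqrt_pos.2 (mul_pos hs hN₀)
  have hT : 0 < T := by positivity
  have hNT : s * N / T ≤ T := by
    rw [← Real.sq_sqrt (mul_pos hs hN₀).le, div_le_iff₀ hT, sq]
    gcongr <;> linarith
  -- Up to constants, this scale and this variance minimise the bound.
  have ht : 0 < √T / s := by positivity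
  let v : ℝ≥0 := ⟨s / T, (div_pos hs hT).le⟩
  have hv : v ≠ 0 := NNReal.coe_ne_zero.1 (div_pos hs hT).ne'
  refine (lintegral_l2_opNorm_le_of_scale hX hV h_indep h_proxy hs.le hVs hR₀ hK₀ hR hK hN hv
    ht).trans (ENNReal.ofReal_le_ofReal ((div_le_iff₀ ht).2 ?_))
  calc 1 / (s / T) + (√T / s) ^ 2 * (s + s / T * (R + K + 2 * τ) + (s / T) ^ 2 * N) / 2
      = (T + (T + (T + τ) + s * N / T) / 2) / s := by
        rw [div_pow, Real.sq_sqrt hT.le, hT_def]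
        field_simp
        ring
    _ ≤ (T + (T + (T + T) + T) / 2) / s := by
        gcongr
        linarith
    _ = 3 * √T * (√T / s) := by
        rw [mul_assoc, ← mul_div_assoc, Real.mul_self_sqrt hT.le]
        ring

end RandomMatrix

section ProductKernel

variable {Ω : Type*} [MeasurableSpace Ω] {P : Measure Ω} {ι J : Type*} [Fintype ι] [Fintype J]
  {E F : J → Type*} [∀ j, MeasurableSpace (E j)] [∀ j, MeasurableSpace (F j)]

theorem measurePreserving_comp_pi (μ : ∀ j, Measure (E j)) [∀ j, IsProbabilityMeasure (μ j)]
    {g : ι → J} (hg : g.Injective) :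
    MeasurePreserving (fun (u : ∀ j, E j) i => u (g i)) (Measure.pi μ)
      (Measure.pi fun i => μ (g i)) where
  measurable := by fun_prop
  map_eq := by
    have h_indep : iIndepFun (fun i (u : ∀ j, E j) => u (g i)) (Measure.pi μ) :=
      (iIndepFun_pi (X := fun _ a => a) fun _ => aemeasurable_id).precomp hg
    rw [h_indep.map_fun_eq_pi_map fun i => (measurable_pi_apply _).aemeasurable]
    exact congrArg Measure.pi (funext fun i => (measurePreserving_eval μ (g i)).map_eq)

theorem hasLaw_prodMk_of_hasLaw_compProd {A : Ω → ∀ j, E j} {B : Ω → ∀ j, F j}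
    [IsProbabilityMeasure P] {η : Kernel (∀ j, E j) (∀ j, F j)} [IsMarkovKernel η]
    {η' : ∀ j, Kernel (E j) (F j)} [∀ j, IsMarkovKernel (η' j)]
    (hη : ∀ a, η a = Measure.pi fun j => η' j (a j))
    (hAB : HasLaw (fun ω => (A ω, B ω)) (P.map A ⊗ₘ η) P) {g : ι → J} (hg : g.Injective)
    (h_indep : iIndepFun (fun i ω => A ω (g i)) P) :
    HasLaw (fun ω i => (A ω (g i), B ω (g i)))
      (Measure.pi fun i => P.map (A · (g i)) ⊗ₘ η' (g i)) P := by
  have hA : AEMeasurable A P := hAB.aemeasurable.fst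
  have hA_eval (j : J) : AEMeasurable (A · j) P := hA.eval j
  have := Measure.isProbabilityMeasure_map hA
  have (j : J) := Measure.isProbabilityMeasure_map (hA_eval j)
  let D (q : (∀ j, E j) × ∀ j, F j) (i : ι) : E (g i) × F (g i) := (q.1 (g i), q.2 (g i))
  have hD : Measurable D := by fun_prop
  refine HasLaw.comp (Y := D) ⟨hD.aemeasurable, (Measure.pi_eq fun s hs => ?_).symm⟩ hAB
  have h_section (a : ∀ j, E j) : η a (Prod.mk a ⁻¹' (D ⁻¹' Set.univ.pi s)) =
      ∏ i, η' (g i) (a (g i)) (Prod.mk (a (g i)) ⁻¹' s i) := by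
    rw [← Measure.pi_pi, ← (measurePreserving_comp_pi (fun j => η' j (a j)) hg).measure_preimage
      (MeasurableSet.univ_pi fun i => measurable_prodMk_left (hs i)).nullMeasurableSet, hη]
    rfl
  have h_meas (i : ι) : Measurable fun b => η' (g i) b (Prod.mk b ⁻¹' s i) :=
    Kernel.measurable_kernel_prodMk_left (hs i)
  calc (P.map A ⊗ₘ η).map D (Set.univ.pi s)
      = ∫⁻ a, ∏ i, η' (g i) (a (g i)) (Prod.mk (a (g i)) ⁻¹' s i) ∂P.map A := by
        rw [Measure.map_apply hD (.univ_pi hs), Measure.compProd_apply (hD (.univ_pi hs))]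
        simp_rw [h_section]
    _ = ∫⁻ ω, ∏ i, η' (g i) (A ω (g i)) (Prod.mk (A ω (g i)) ⁻¹' s i) ∂P :=
        lintegral_map' (Finset.measurable_prod _ fun i _ =>
          (h_meas i).comp (measurable_pi_apply _)).aemeasurable hA
    _ = ∏ i, ∫⁻ ω, η' (g i) (A ω (g i)) (Prod.mk (A ω (g i)) ⁻¹' s i) ∂P :=
        lintegral_prod_comp_of_iIndepFun (fun i => hA_eval (g i)) h_indep h_meas
    _ = ∏ i, (P.map (A · (g i)) ⊗ₘ η' (g i)) (s i) := by
        refine Finset.prod_congr rfl fun i _ => ?_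
        rw [Measure.compProd_apply (hs i), lintegral_map' (h_meas i).aemeasurable (hA_eval (g i))]

end ProductKernel

section SparseGaussian

open unitInterval

/-- The law of a centred Gaussian variable of variance `s` which is kept with probability `p` and
replaced by `0` otherwise: the law of the change which pruning makes to a Gaussian weight. -/
noncomputable def sparseGaussian (p : I) (s : ℝ≥0) : Measure ℝ :=
  toNNReal p • gaussianReal 0 s + toNNReal (σ p) • Measure.dirac 0

/-- The variance proxy of a sparse Gaussian variable with value `a`: it is `s` if the Gaussian
variable has been kept, that is, almost surely, if `a ≠ 0`. -/
noncomputable def sparseVariance (s : ℝ≥0) : ℝ → ℝ :=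
  ({0}ᶜ : Set ℝ).indicator fun _ => s

theorem sparseVariance_zero (s : ℝ≥0) : sparseVariance s 0 = 0 :=
  Set.indicator_of_notMem (by simp) _

theorem sparseVariance_mem_Icc (s : ℝ≥0) (a : ℝ) : sparseVariance s a ∈ Set.Icc 0 (s : ℝ) :=
  ⟨Set.indicator_nonneg (fun _ _ => s.2) _, Set.indicator_le_self' (fun _ _ => s.2) _⟩

@[fun_prop]
theorem measurable_sparseVariance (s : ℝ≥0) : Measurable (sparseVariance s) :=
  measurable_const.indicator (measurableSet_singleton 0).compl

theorem sparseVariance_ae_eq_gaussianReal (s : ℝ≥0) :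
    sparseVariance s =ᵐ[gaussianReal 0 s] fun _ => s := by
  rcases eq_or_ne s 0 with rfl | hs
  · simp [sparseVariance]
  · have := nullSingletonClass_gaussianReal (μ := 0) hs
    filter_upwards [Measure.ae_ne (gaussianReal 0 s) 0] with a ha using Set.indicator_of_mem ha _

theorem lintegral_sparseGaussian (p : I) (s : ℝ≥0) {f : ℝ → ENNReal} (hf : Measurable f) :
    ∫⁻ a, f a ∂sparseGaussian p s =
      toNNReal p * ∫⁻ a, f a ∂gaussianReal 0 s + toNNReal (σ p) * f 0 := by
  rw [sparseGaussian, lintegral_add_measure, lintegral_smul_measure, lintegral_smul_measure,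
    lintegral_dirac' _ hf]
  rfl

instance (p : I) (s : ℝ≥0) : IsProbabilityMeasure (sparseGaussian p s) where
  measure_univ := by
    rw [← lintegral_one, lintegral_sparseGaussian p s measurable_const, lintegral_one,
      measure_univ, mul_one, mul_one, ← ENNReal.coe_add, toNNReal_add_toNNReal_symm,
      ENNReal.coe_one]

theorem lintegral_exp_gaussianReal (t : ℝ) (s : ℝ≥0) :
    ∫⁻ a, ENNReal.ofReal (Real.exp (t * a - t ^ 2 / 2 * s)) ∂gaussianReal 0 s = 1 := by
  have h_mgf : ∫ a, Real.exp (t * a) ∂gaussianReal 0 s = Real.exp (0 * t + s * t ^ 2 / 2) :=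
    mgf_gaussianReal HasLaw.id.map_eq t
  have h_exponent : 0 * t + s * t ^ 2 / 2 = t ^ 2 / 2 * s := by ring
  simp_rw [Real.exp_sub]
  rw [← ofReal_integral_eq_lintegral_ofReal ((integrable_exp_mul_gaussianReal t).div_const _)
    (.of_forall fun a => by positivity), integral_div, h_mgf, h_exponent,
    div_self (Real.exp_pos _).ne', ENNReal.ofReal_one]

variable {Ω : Type*} [MeasurableSpace Ω] {P : Measure Ω}

theorem hasVarianceProxy_of_hasLaw_sparseGaussian {X : Ω → ℝ} {p : I} {s : ℝ≥0}
    (hX : HasLaw X (sparseGaussian p s) P) :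
    HasVarianceProxy X (fun ω => sparseVariance s (X ω)) P := by
  intro t
  let f (a : ℝ) : ENNReal :=
    ENNReal.ofReal (Real.exp (t * a - t ^ 2 / 2 * sparseVariance s a))
  have hf : Measurable f := by fun_prop
  have hf_gaussian : ∫⁻ a, f a ∂gaussianReal 0 s = 1 := by
    rw [← lintegral_exp_gaussianReal t s]
    refine lintegral_congr_ae ?_
    filter_upwards [sparseVariance_ae_eq_gaussianReal s] with a ha
    simp only [f, ha]
  have hf_zero : f 0 = 1 := by simp [f, sparseVariance_zero]
  calc ∫⁻ ω, f (X ω) ∂P = ∫⁻ a, f a ∂sparseGaussian p s := hX.lintegral_comp hf.aemeasurable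
    _ ≤ 1 := by
        rw [lintegral_sparseGaussian p s hf, hf_gaussian, hf_zero, mul_one, mul_one,
          ← ENNReal.coe_add, toNNReal_add_toNNReal_symm, ENNReal.coe_one]

theorem integral_sparseVariance_of_hasLaw_sparseGaussian {X : Ω → ℝ} {p : I} {s : ℝ≥0}
    (hX : HasLaw X (sparseGaussian p s) P) : ∫ ω, sparseVariance s (X ω) ∂P = p * s := by
  have h_integrable (μ : Measure ℝ) [IsFiniteMeasure μ] : Integrable (sparseVariance s) μ :=
    (integrable_const _).indicator (measurableSet_singleton 0).compl
  calc ∫ ω, sparseVariance s (X ω) ∂P = ∫ a, sparseVariance s a ∂sparseGaussian p s :=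
        hX.integral_comp (measurable_sparseVariance s).aestronglyMeasurable
    _ = toNNReal p • (s : ℝ) := by
        rw [sparseGaussian, integral_add_measure (h_integrable _) (h_integrable _),
          integral_smul_nnreal_measure, integral_smul_nnreal_measure,
          integral_congr_ae (sparseVariance_ae_eq_gaussianReal s), integral_const, probReal_univ,
          one_smul, integral_dirac, sparseVariance_zero, smul_zero, add_zero]

theorem sqrt_add_le_sqrt_add_sqrt {a b : ℝ} (ha : 0 ≤ a) (hb : 0 ≤ b) : √(a + b) ≤ √a + √b := by
  rw [Real.sqrt_le_left (by positivity), add_sq, Real.sq_sqrt ha, Real.sq_sqrt hb]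
  linarith [mul_nonneg (Real.sqrt_nonneg a) (Real.sqrt_nonneg b)]

theorem sqrt_add_add_sqrt_le {m n q s : ℝ} (hm : 0 ≤ m) (hn : 0 ≤ n) (hq : 0 ≤ q) (hs : 0 ≤ s) :
    √(n * (q * s) + m * (q * s) + √(s * (m * (n * (q * s)))))
      ≤ √(q * s) * (√m + √n) + √(s * √(m * n * q)) := by
  have h_inner : √(s * (m * (n * (q * s)))) = s * √(m * n * q) := by
    rw [show s * (m * (n * (q * s))) = s ^ 2 * (m * n * q) by ring, Real.sqrt_mul (sq_nonneg s),
      Real.sqrt_sq hs]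
  calc _ ≤ √(n * (q * s)) + √(m * (q * s)) + √(s * √(m * n * q)) := by
        rw [h_inner]
        grw [sqrt_add_le_sqrt_add_sqrt (by positivity) (by positivity),
          sqrt_add_le_sqrt_add_sqrt (by positivity) (by positivity)]
    _ = _ := by
        rw [Real.sqrt_mul hn, Real.sqrt_mul hm]
        ring

open scoped Matrix.Norms.L2Operator

variable [IsProbabilityMeasure P] {ι κ : Type*} [Fintype ι] [Fintype κ] [DecidableEq κ]

theorem lintegral_l2_opNorm_le_of_hasLaw_sparseGaussian {X : Ω → Matrix ι κ ℝ} {p : ι → κ → I}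
    {q : I} {s : ℝ≥0} (hs : 0 < s) (hq : 0 < q) (hpq : ∀ i j, p i j ≤ q)
    (hX : ∀ i j, HasLaw (X · i j) (sparseGaussian (p i j) s) P)
    (h_indep : iIndepFun (fun (e : ι × κ) ω => X ω e.1 e.2) P) :
    ∫⁻ ω, ENNReal.ofReal ‖X ω‖ ∂P ≤ ENNReal.ofReal
      (3 * (√(q * s) * (√(Fintype.card ι : ℝ) + √(Fintype.card κ : ℝ))
        + √(s * √(Fintype.card ι * Fintype.card κ * q)))) := by
  rcases isEmpty_or_nonempty (ι × κ) with h_empty | ⟨i₀, j₀⟩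
  · have : Subsingleton (Matrix ι κ ℝ) := ⟨fun M N => by ext i j; exact h_empty.elim (i, j)⟩
    simp [Subsingleton.elim (X _) 0]
  have : Nonempty ι := ⟨i₀⟩
  have : Nonempty κ := ⟨j₀⟩
  have hq' : (0 : ℝ) < q := hq
  have hs' : (0 : ℝ) < s := hs
  let V (ω : Ω) : Matrix ι κ ℝ := Matrix.of fun i j => sparseVariance s (X ω i j)
  have h_mean (i : ι) (j : κ) : ∫ ω, V ω i j ∂P ≤ q * s := by
    refine (integral_sparseVariance_of_hasLaw_sparseGaussian (hX i j)).trans_le ?_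
    gcongr
    exact hpq i j
  have h_row (i : ι) : ∑ j, ∫ ω, V ω i j ∂P ≤ Fintype.card κ * (q * s) :=
    (Finset.sum_le_card_nsmul _ _ _ fun j _ => h_mean i j).trans_eq (nsmul_eq_mul _ _)
  have h_col (j : κ) : ∑ i, ∫ ω, V ω i j ∂P ≤ Fintype.card ι * (q * s) :=
    (Finset.sum_le_card_nsmul _ _ _ fun i _ => h_mean i j).trans_eq (nsmul_eq_mul _ _)
  have h_total : ∑ i, ∑ j, ∫ ω, V ω i j ∂P ≤ Fintype.card ι * (Fintype.card κ * (q * s)) :=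
    (Finset.sum_le_card_nsmul _ _ _ fun i _ => h_row i).trans_eq (nsmul_eq_mul _ _)
  have h_norm := lintegral_l2_opNorm_le (fun i j => (hX i j).aemeasurable)
    (fun i j => (measurable_sparseVariance s).comp_aemeasurable (hX i j).aemeasurable)
    (h_indep.comp (fun _ a => (a, sparseVariance s a)) fun _ => by fun_prop)
    (fun i j => hasVarianceProxy_of_hasLaw_sparseGaussian (hX i j)) hs'
    (fun ω i j => sparseVariance_mem_Icc s (X ω i j)) (by positivity) (by positivity)
    (by positivity) h_row h_col h_total
  grw [h_norm, sqrt_add_add_sqrt_le (by positivity) (by positivity) hq'.le hs'.le]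

end SparseGaussian

section PruningError

open unitInterval

/-- The pruning step at the position `e`, as a Markov kernel. -/
noncomputable def pruneKernel {L : ℕ} {d₁ d₂ : Fin L → ℕ} (d Ψ : ℝ≥0) (e : Entry d₁ d₂) :
    Kernel ℝ ℝ where
  toFun := pruneEntry d Ψ e
  measurable' := measurable_pruneEntry d Ψ e

instance {L : ℕ} {d₁ d₂ : Fin L → ℕ} (d Ψ : ℝ≥0) (e : Entry d₁ d₂) :
    IsMarkovKernel (pruneKernel d Ψ e) :=
  ⟨fun a => inferInstanceAs (IsProbabilityMeasure (pruneEntry d Ψ e a))⟩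

/-- The probability with which the pruning step removes a centred Gaussian weight which is not on
the diagonal; it does not depend on the variance `Ψ` of the weight. -/
noncomputable def pruneRate (d : ℝ≥0) : I :=
  ⟨√(d / (d + 2)), Real.sqrt_nonneg _,
    Real.sqrt_le_one.2 (div_le_one_of_le₀ (by linarith) (by positivity))⟩

theorem pruneRate_pos {d : ℝ≥0} (hd : 0 < d) : 0 < pruneRate d :=
  Real.sqrt_pos.2 (div_pos hd (by positivity))

/-- The probability with which the pruning step removes the centred Gaussian weight at the
position `e`. -/
noncomputable def entryPruneRate {L : ℕ} {d₁ d₂ : Fin L → ℕ} (d : ℝ≥0) (e : Entry d₁ d₂) : I :=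
  if (e.2.1 : ℕ) = e.2.2 then 0 else pruneRate d

theorem entryPruneRate_le {L : ℕ} {d₁ d₂ : Fin L → ℕ} (d : ℝ≥0) (e : Entry d₁ d₂) :
    entryPruneRate d e ≤ pruneRate d := by
  unfold entryPruneRate
  split_ifs
  exacts [nonneg', le_rfl]

@[fun_prop]
theorem measurable_pruneProb (d Ψ : ℝ≥0) : Measurable (pruneProb d Ψ) := by
  unfold pruneProb
  fun_prop

theorem lintegral_pruneEntry_of_ne {L : ℕ} {d₁ d₂ : Fin L → ℕ} (d Ψ : ℝ≥0) {e : Entry d₁ d₂}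
    (he : (e.2.1 : ℕ) ≠ e.2.2) (a : ℝ) {f : ℝ → ENNReal} (hf : Measurable f) :
    ∫⁻ b, f b ∂pruneEntry d Ψ e a =
      toNNReal (pruneProb d Ψ a) * f 0 + toNNReal (σ (pruneProb d Ψ a)) * f a := by
  rw [pruneEntry, if_neg he, bernoulliMeasure_def, lintegral_add_measure, lintegral_smul_measure,
    lintegral_smul_measure, lintegral_dirac' _ hf, lintegral_dirac' _ hf]
  rfl

variable {d Ψ : ℝ≥0}

theorem gaussianPDF_mul_pruneProb (hd : 0 < d) (hΨ : 0 < Ψ) (a : ℝ) :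
    gaussianPDF 0 Ψ a * toNNReal (pruneProb d Ψ a) =
      toNNReal (pruneRate d) * gaussianPDF 0 (Ψ * (d / (d + 2))) a := by
  have : (0 : ℝ) < d := hd
  have : (0 : ℝ) < Ψ := hΨ
  have : 0 < √((d : ℝ) / (d + 2)) := pruneRate_pos hd
  rw [gaussianPDF, gaussianPDF, ← ENNReal.ofReal_coe_nnreal, ← ENNReal.ofReal_coe_nnreal,
    ← ENNReal.ofReal_mul (gaussianPDFReal_nonneg _ _ _), ← ENNReal.ofReal_mul (NNReal.coe_nonneg _)]
  congr 1
  simp only [gaussianPDFReal, coe_toNNReal, pruneProb, pruneRate]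
  push_cast
  rw [mul_assoc, ← Real.exp_add, ← mul_assoc]
  congr 2
  · rw [← mul_assoc (2 * Real.pi), Real.sqrt_mul (by positivity : 0 ≤ 2 * Real.pi * (Ψ : ℝ))]
    field_simp
  · field_simp
    ring

theorem lintegral_pruneProb_mul (hd : 0 < d) (hΨ : 0 < Ψ) {f : ℝ → ENNReal} (hf : Measurable f) :
    ∫⁻ a, toNNReal (pruneProb d Ψ a) * f a ∂gaussianReal 0 Ψ =
      toNNReal (pruneRate d) * ∫⁻ a, f a ∂gaussianReal 0 (Ψ * (d / (d + 2))) := by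
  rw [gaussianReal_of_var_ne_zero 0 hΨ.ne',
    gaussianReal_of_var_ne_zero 0 (mul_pos hΨ (div_pos hd (by positivity))).ne',
    lintegral_withDensity_eq_lintegral_mul _ (by fun_prop) (by fun_prop),
    lintegral_withDensity_eq_lintegral_mul _ (by fun_prop) hf,
    ← lintegral_const_mul _ (by fun_prop)]
  refine lintegral_congr fun a => ?_
  simp only [Pi.mul_apply]
  rw [← mul_assoc, gaussianPDF_mul_pruneProb hd hΨ, mul_assoc]

theorem lintegral_symm_pruneProb (hd : 0 < d) (hΨ : 0 < Ψ) :
    ∫⁻ a, toNNReal (σ (pruneProb d Ψ a)) ∂gaussianReal 0 Ψ = toNNReal (σ (pruneRate d)) := by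
  have h_pruned : ∫⁻ a, toNNReal (pruneProb d Ψ a) ∂gaussianReal 0 Ψ = toNNReal (pruneRate d) := by
    simpa only [mul_one, lintegral_one, measure_univ] using
      lintegral_pruneProb_mul hd hΨ (f := fun _ => 1) measurable_const
  have h_total : ∫⁻ a, toNNReal (pruneProb d Ψ a) ∂gaussianReal 0 Ψ
      + ∫⁻ a, toNNReal (σ (pruneProb d Ψ a)) ∂gaussianReal 0 Ψ
      = toNNReal (pruneRate d) + toNNReal (σ (pruneRate d)) := by
    rw [← lintegral_add_left (by fun_prop)]
    simp only [← ENNReal.coe_add, toNNReal_add_toNNReal_symm, lintegral_const, measure_univ,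
      mul_one]
  rw [h_pruned] at h_total
  exact (ENNReal.add_right_inj ENNReal.coe_ne_top).1 h_total

theorem map_sub_compProd_pruneKernel {L : ℕ} {d₁ d₂ : Fin L → ℕ} (hd : 0 < d) (hΨ : 0 < Ψ)
    (e : Entry d₁ d₂) :
    ((gaussianReal 0 Ψ) ⊗ₘ pruneKernel d Ψ e).map (fun q => q.2 - q.1) =
      sparseGaussian (entryPruneRate d e) (Ψ * (d / (d + 2))) := by
  refine Measure.ext_of_lintegral _ fun f hf => ?_
  rw [lintegral_map hf (by fun_prop), Measure.lintegral_compProd (by fun_prop),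
    lintegral_sparseGaussian _ _ hf]
  change ∫⁻ a, ∫⁻ b, f (b - a) ∂pruneEntry d Ψ e a ∂gaussianReal 0 Ψ = _
  by_cases he : (e.2.1 : ℕ) = e.2.2
  · have h_kept (a : ℝ) : ∫⁻ b, f (b - a) ∂pruneEntry d Ψ e a = f 0 := by
      rw [pruneEntry, if_pos he, lintegral_dirac' _ (by fun_prop), sub_self]
    simp [h_kept, entryPruneRate, he]
  · have h_neg : ∫⁻ a, f (-a) ∂gaussianReal 0 (Ψ * (d / (d + 2))) =
        ∫⁻ a, f a ∂gaussianReal 0 (Ψ * (d / (d + 2))) := by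
      rw [← lintegral_map hf measurable_neg, gaussianReal_map_neg, neg_zero]
    have h_step (a : ℝ) : ∫⁻ b, f (b - a) ∂pruneEntry d Ψ e a =
        toNNReal (pruneProb d Ψ a) * f (-a) + toNNReal (σ (pruneProb d Ψ a)) * f 0 := by
      rw [lintegral_pruneEntry_of_ne d Ψ he a (by fun_prop), zero_sub, sub_self]
    simp_rw [h_step]
    rw [lintegral_add_left (by fun_prop), lintegral_mul_const _ (by fun_prop),
      lintegral_pruneProb_mul hd hΨ (by fun_prop), lintegral_symm_pruneProb hd hΨ, h_neg,
      entryPruneRate, if_neg he]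

variable {L : ℕ} {d₁ d₂ : Fin L → ℕ} {Ω : Type*} [MeasurableSpace Ω] {P : Measure Ω}
  [IsProbabilityMeasure P] {A Ahat : Ω → Model d₁ d₂}

theorem hasLaw_layer_sub (hd : 0 < d) (hΨ : 0 < Ψ) {l : Fin L}
    (hA : ∀ p : Fin (d₁ l) × Fin (d₂ l), HasLaw (fun ω => A ω ⟨l, p⟩) (gaussianReal 0 Ψ) P)
    (h_indep : iIndepFun (fun (p : Fin (d₁ l) × Fin (d₂ l)) ω => A ω ⟨l, p⟩) P)
    (hJ : HasLaw (fun ω => (A ω, Ahat ω)) (P.map A ⊗ₘ mbp d₁ d₂ d Ψ) P) :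
    HasLaw (fun ω (p : Fin (d₁ l) × Fin (d₂ l)) => Ahat ω ⟨l, p⟩ - A ω ⟨l, p⟩)
      (Measure.pi fun p =>
        sparseGaussian (entryPruneRate d (⟨l, p⟩ : Entry d₁ d₂)) (Ψ * (d / (d + 2)))) P := by
  have h_pairs := hasLaw_prodMk_of_hasLaw_compProd (η' := pruneKernel d Ψ) (fun _ => rfl) hJ
    (sigma_mk_injective (i := l)) h_indep
  simp_rw [fun p => (hA p).map_eq] at h_pairs
  simp_rw [← map_sub_compProd_pruneKernel hd hΨ]
  have h_sub : Measurable fun q : ℝ × ℝ => q.2 - q.1 := by fun_prop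
  have (p : Fin (d₁ l) × Fin (d₂ l)) := Measure.isProbabilityMeasure_map
    (μ := gaussianReal 0 Ψ ⊗ₘ pruneKernel d Ψ (⟨l, p⟩ : Entry d₁ d₂)) h_sub.aemeasurable
  exact (measurePreserving_pi _ _ fun _ => h_sub.measurePreserving _).comp_hasLaw h_pairs

end PruningError

section LayerGamma

theorem rpow_one_div_four {x : ℝ} (hx : 0 ≤ x) : x ^ (1 / 4 : ℝ) = √√x := by
  rw [Real.sqrt_eq_rpow, Real.sqrt_eq_rpow, ← Real.rpow_mul hx]
  norm_num

theorem rpow_nat_add_one_div_two {r : ℝ} (hr : 0 < r) (k : ℕ) :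
    r ^ (k + 1 / 2 : ℝ) = r ^ k * √r := by
  rw [Real.rpow_add hr, Real.rpow_natCast, Real.sqrt_eq_rpow]

theorem layerGamma_nonneg {C d : ℝ} (hC : 0 ≤ C) (hd : 0 ≤ d) (Ψ : ℝ) (m n : ℕ) :
    0 ≤ layerGamma C d Ψ m n := by
  unfold layerGamma
  positivity

theorem le_layerGamma {C d Ψ : ℝ} (hC : 0 ≤ C) (hd : 0 < d) (hΨ : 0 ≤ Ψ) (m n : ℕ) :
    C * (√(√(d / (d + 2)) * (Ψ * (d / (d + 2)))) * (√m + √n)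
      + √(Ψ * (d / (d + 2)) * √(m * n * √(d / (d + 2))))) ≤ layerGamma C d Ψ m n := by
  unfold layerGamma
  set r : ℝ := d / (d + 2)
  have hr_pos : 0 < r := by positivity
  have h_rpow (a : ℝ) : d ^ a / (d + 2) ^ a = r ^ a := (Real.div_rpow hd.le (by positivity) a).symm
  have h_linear : d ^ (3 / 2 : ℝ) * Ψ / (d + 2) ^ (3 / 2 : ℝ) = √r * (Ψ * r) := by
    have := rpow_nat_add_one_div_two hr_pos 1
    rw [mul_div_right_comm, h_rpow, show (3 / 2 : ℝ) = (1 : ℕ) + 1 / 2 by norm_num, this]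
    ring
  have h_quartic : 3 * m * n * d ^ (5 / 2 : ℝ) * Ψ ^ 2 / (d + 2) ^ (5 / 2 : ℝ)
      = 3 * ((Ψ * r) ^ 2 * (m * n * √r)) := by
    have := rpow_nat_add_one_div_two hr_pos 2
    rw [mul_div_right_comm, mul_div_assoc, h_rpow,
      show (5 / 2 : ℝ) = (2 : ℕ) + 1 / 2 by norm_num, this]
    ring
  set x : ℝ := (Ψ * r) ^ 2 * (m * n * √r) with hx
  have hx_nonneg : 0 ≤ x := by positivity
  have h_sqrt : Ψ * r * √(m * n * √r) = √x := by
    rw [hx, Real.sqrt_mul (sq_nonneg _), Real.sqrt_sq (by positivity)]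
  rw [h_linear, h_quartic, rpow_one_div_four (by positivity), h_sqrt]
  gcongr
  linarith

end LayerGamma

section MainTheorem

variable {Ω : Type*} [MeasurableSpace Ω] {P : Measure Ω}

theorem one_sub_one_div_le_probReal_le_mul [IsProbabilityMeasure P] {f : Ω → ℝ}
    (hf : AEMeasurable f P) {G ε : ℝ}
    (hG : 0 ≤ G) (hε : 0 < ε) (h : ∫⁻ ω, ENNReal.ofReal (f ω) ∂P ≤ ENNReal.ofReal G) :
    1 - 1 / ε ≤ P.real {ω | f ω ≤ ε * G} := by
  have h_null : NullMeasurableSet {ω | f ω ≤ ε * G} P := nullMeasurableSet_le hf aemeasurable_const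
  suffices h_compl : P {ω | f ω ≤ ε * G}ᶜ ≤ ENNReal.ofReal (1 / ε) by
    have := ENNReal.toReal_le_of_le_ofReal (by positivity) h_compl
    rw [← measureReal_def, probReal_compl_eq_one_sub₀ h_null] at this
    linarith
  rcases hG.eq_or_lt with rfl | hG
  · rw [ENNReal.ofReal_zero, nonpos_iff_eq_zero, lintegral_eq_zero_iff' hf.ennreal_ofReal] at h
    have : ∀ᵐ ω ∂P, f ω ≤ ε * 0 := by
      filter_upwards [h] with ω hω
      simpa only [mul_zero] using ENNReal.ofReal_eq_zero.1 hω
    exact (mem_ae_iff.1 this).trans_le zero_le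
  calc P {ω | f ω ≤ ε * G}ᶜ ≤ P {ω | ENNReal.ofReal (ε * G) ≤ ENNReal.ofReal (f ω)} :=
        measure_mono fun ω hω => ENNReal.ofReal_le_ofReal (le_of_not_ge hω)
    _ ≤ (∫⁻ ω, ENNReal.ofReal (f ω) ∂P) / ENNReal.ofReal (ε * G) :=
        meas_ge_le_lintegral_div hf.ennreal_ofReal (by simpa using mul_pos hε hG)
          ENNReal.ofReal_ne_top
    _ ≤ ENNReal.ofReal G / ENNReal.ofReal (ε * G) := by gcongr
    _ = ENNReal.ofReal (1 / ε) := by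
        rw [← ENNReal.ofReal_div_of_pos (by positivity)]
        congr 1
        field_simp

variable {L : ℕ} {d₁ d₂ : Fin L → ℕ} {d Ψ : ℝ≥0} {A Ahat : Ω → Model d₁ d₂}

open scoped Matrix.Norms.L2Operator in
theorem measurable_spectralNorm₂_layer_sub (l : Fin L) :
    Measurable fun q : Model d₁ d₂ × Model d₁ d₂ =>
      spectralNorm₂ (q.2.layer l - q.1.layer l) := by
  have h_layer : Continuous fun q : Model d₁ d₂ × Model d₁ d₂ => q.2.layer l - q.1.layer l := by
    refine continuous_matrix fun i j => ?_
    simp only [Model.layer, Matrix.sub_apply, Matrix.of_apply]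
    fun_prop
  exact h_layer.norm.measurable

theorem aemeasurable_spectralNorm₂_layer_sub (hA : AEMeasurable A P) (hAhat : AEMeasurable Ahat P)
    (l : Fin L) :
    AEMeasurable (fun ω => spectralNorm₂ ((Ahat ω).layer l - (A ω).layer l)) P :=
  Measurable.comp_aemeasurable (f := fun ω => (A ω, Ahat ω)) (measurable_spectralNorm₂_layer_sub l)
    (hA.prodMk hAhat)

theorem lintegral_spectralNorm₂_layer_sub_le [IsProbabilityMeasure P] (hd : 0 < d) (hΨ : 0 < Ψ)
    {l : Fin L}
    (hA : ∀ p : Fin (d₁ l) × Fin (d₂ l), HasLaw (fun ω => A ω ⟨l, p⟩) (gaussianReal 0 Ψ) P)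
    (h_indep : iIndepFun (fun (p : Fin (d₁ l) × Fin (d₂ l)) ω => A ω ⟨l, p⟩) P)
    (hJ : HasLaw (fun ω => (A ω, Ahat ω)) (P.map A ⊗ₘ mbp d₁ d₂ d Ψ) P) :
    ∫⁻ ω, ENNReal.ofReal (spectralNorm₂ ((Ahat ω).layer l - (A ω).layer l)) ∂P ≤
      ENNReal.ofReal (layerGamma 3 d Ψ (d₁ l) (d₂ l)) := by
  have h_law := hasLaw_layer_sub hd hΨ hA h_indep hJ
  have h_entry (p) := (measurePreserving_eval _ p).comp_hasLaw h_law
  let X (ω : Ω) : Matrix (Fin (d₁ l)) (Fin (d₂ l)) ℝ :=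
    Matrix.of fun i j => Ahat ω ⟨l, i, j⟩ - A ω ⟨l, i, j⟩
  have hX (ω : Ω) : (Ahat ω).layer l - (A ω).layer l = X ω := rfl
  have h_norm := lintegral_l2_opNorm_le_of_hasLaw_sparseGaussian (X := X)
    (mul_pos hΨ (div_pos hd (by positivity))) (pruneRate_pos hd)
    (fun i j => entryPruneRate_le d (⟨l, i, j⟩ : Entry d₁ d₂)) (fun i j => h_entry (i, j))
    ((iIndepFun_iff_hasLaw_pi_pi h_entry).2 h_law)
  simp_rw [hX]
  refine h_norm.trans (ENNReal.ofReal_le_ofReal ?_)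
  rw [Fintype.card_fin, Fintype.card_fin]
  exact le_layerGamma zero_le_three hd Ψ.2 (d₁ l) (d₂ l)

end MainTheorem

theorem mainTheorem4 :
    ∃ C : ℝ, 0 < C ∧
      ∀ (L : ℕ) (d₁ d₂ : Fin L → ℕ) (d Ψ : ℝ≥0), 0 < d → 0 < Ψ →
      ∀ (Ω : Type*) [MeasurableSpace Ω] (P : Measure Ω) [IsProbabilityMeasure P]
        (A Ahat : Ω → Model d₁ d₂),
        -- every weight is a centred Gaussian of variance `Ψ`
        (∀ e, HasLaw (fun ω => A ω e) (gaussianReal 0 Ψ) P) →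
        -- the weights within each layer are independent
        (∀ l : Fin L, iIndepFun (fun (p : Fin (d₁ l) × Fin (d₂ l)) ω => A ω ⟨l, p⟩) P) →
        -- the pruned model is the output of the pruning algorithm run on `A`
        HasLaw (fun ω => (A ω, Ahat ω)) ((P.map A).compProd (mbp d₁ d₂ d Ψ)) P →
      ∀ (l : Fin L) (ε : ℝ), 0 < ε →
        1 - 1 / ε ≤ P.real {ω | spectralNorm₂ ((Ahat ω).layer l - (A ω).layer l)
          ≤ ε * layerGamma C d Ψ (d₁ l) (d₂ l)} := by
  refine ⟨3, zero_lt_three, fun L d₁ d₂ d Ψ hd hΨ Ω _ P _ A Ahat hA h_indep hJ l ε hε => ?_⟩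
  have h_meas : AEMeasurable (fun ω => spectralNorm₂ ((Ahat ω).layer l - (A ω).layer l)) P :=
    aemeasurable_spectralNorm₂_layer_sub hJ.aemeasurable.fst hJ.aemeasurable.snd l
  have h_mean : ∫⁻ ω, ENNReal.ofReal (spectralNorm₂ ((Ahat ω).layer l - (A ω).layer l)) ∂P ≤
      ENNReal.ofReal (layerGamma 3 d Ψ (d₁ l) (d₂ l)) :=
    lintegral_spectralNorm₂_layer_sub_le hd hΨ (fun p => hA ⟨l, p⟩) (h_indep l) hJ
  have h_nonneg : 0 ≤ layerGamma 3 d Ψ (d₁ l) (d₂ l) :=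
    layerGamma_nonneg zero_le_three d.coe_nonneg Ψ (d₁ l) (d₂ l)
  exact one_sub_one_div_le_probReal_le_mul h_meas h_nonneg hε h_mean
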